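/- Let $p\in(0,1]$ and $s>\frac12$, and let $R_p(1),R_p(2),\dots$ be independent, identically distributed random variables with $\mathrm{Prob}(R_p(n)=0)=1-p$ and $\mathrm{Prob}(R_p(n)=1)=\mathrm{Prob}(R_p(n)=-1)=\frac p2$. Then the random series $$\Omega_p^\zeta(s)=\sum_{n=1}^\infty R_p(n)\frac1{n^s}=\lim_{N\to\infty}\sum_{n=1}^N R_p(n)\frac1{n^s}$$ converges with probability $1$. For every $t\in\mathbb R$ the infinite product $$\mathrm{Cl}_{p;s}(t)=\prod_{n=1}^\infty\left[1-p+p\cos\left(\frac t{n^s}\right)\right]$$ converges, and $\mathrm{Cl}_{p;s}$ is the characteristic function of $\Omega_p^\zeta(s)$, i.e. $\mathbb E\big[e^{it\Omega_p^\zeta(s)}\big]=\mathrm{Cl}_{p;s}(t)$ for all $t\in\mathbb R$. The law of $\Omega_p^\zeta(s)$ is absolutely continuous with respect to Lebesgue measure on $\mathbb R$ and has a probability density $f_{\Omega_p^\zeta(s)}$ that is a Schwartz function. When $s>1$, this density is not real analytic on $\mathbb R$. -/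

import Mathlib

open MeasureTheory ProbabilityTheory Filter Topology

noncomputable section

/-- `R` is an i.i.d. sequence of random coefficients in `{-1, 0, 1}`, where
`Prob (R n = 0) = 1 - p` and `Prob (R n = 1) = p / 2 = Prob (R n = -1)`.
The sequence is indexed from `0`: `R n` is the coefficient of `1 / (n + 1) ^ s`. -/
structure IsZetaCoeffSeq {Ω : Type*} [MeasurableSpace Ω] (μ : Measure Ω) (p : ℝ)
    (R : ℕ → Ω → ℝ) : Prop where
  measurable : ∀ n, Measurable (R n)
  indep : iIndepFun R μ
  prob_zero : ∀ n, μ {ω | R n ω = 0} = ENNReal.ofReal (1 - p)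
  prob_one : ∀ n, μ {ω | R n ω = 1} = ENNReal.ofReal (p / 2)
  prob_neg_one : ∀ n, μ {ω | R n ω = -1} = ENNReal.ofReal (p / 2)

/-- The random Riemann zeta walk after `N` steps:
`R(1) / 1 ^ s + R(2) / 2 ^ s + ... + R(N) / N ^ s`. -/
def zetaWalk {Ω : Type*} (R : ℕ → Ω → ℝ) (s : ℝ) (N : ℕ) (ω : Ω) : ℝ :=
  ∑ n ∈ Finset.range N, R n ω * (1 / ((n : ℝ) + 1) ^ s)

/-- The random Riemann zeta function at `s`: the limit of the walk (an unspecified value where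
the walk does not converge). -/
def randomZeta {Ω : Type*} (R : ℕ → Ω → ℝ) (s : ℝ) (ω : Ω) : ℝ :=
  limUnder atTop (fun N : ℕ => zetaWalk R s N ω)

/-- The `n`-th factor (indexed from `0`) of the trigonometric product. -/
def cloitreFactor (p s t : ℝ) (n : ℕ) : ℝ :=
  1 - p + p * Real.cos (t / ((n : ℝ) + 1) ^ s)

/-- The trigonometric product `∏_{n ≥ 1} (1 - p + p cos (t / n ^ s))`. -/
def cloitre (p s t : ℝ) : ℝ :=
  ∏' n : ℕ, cloitreFactor p s t n

end

open scoped FourierTransform SchwartzMap NNReal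

/-! The coefficients are centred and sub-Gaussian, and `∑ n^(-2s)` converges for `s > 1/2`. The walk
is therefore an `L¹`-bounded martingale with a uniform sub-Gaussian constant, so it converges almost
surely. By Fatou the limit is sub-Gaussian and has all moments. Independence gives the
characteristic functions of the partial sums, and dominated convergence carries them to the product.

For large `|t|`, about `|t|^(1/s)` factors have angle in `[4^(-s), 1]`, and each of these is at most
some `q < 1` (`abs_cloitre_le_pow`). The product thus decays faster than any power. The moments
bound every derivative, so interpolation makes the characteristic function Schwartz; Fourier
inversion and uniqueness then give the Schwartz density (`exists_schwartz_density`).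

For `s > 1` the limit is bounded, so the density vanishes on a half-line and the identity theorem
rules out analyticity. -/

/-! ### Decay of derivatives by interpolation -/

theorem norm_deriv_le_of_norm_iteratedDeriv_two_le {E : Type*} [NormedAddCommGroup E]
    [NormedSpace ℝ E] {g : ℝ → E} (hg : ContDiff ℝ 2 g)
    {x h ε M : ℝ} (hh : 0 < h) (h0 : ‖g x‖ ≤ ε) (h1 : ‖g (x + h)‖ ≤ ε)
    (hM : ∀ y, ‖iteratedDeriv 2 g y‖ ≤ M) : ‖deriv g x‖ ≤ 2 * ε / h + M * h := by
  have hd : Differentiable ℝ g := hg.differentiable (by norm_num)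
  have hd' : Differentiable ℝ (deriv g) := by
    have := hg.differentiable_iteratedDeriv 1 (by norm_num)
    rwa [iteratedDeriv_one] at this
  have hlip : ∀ y ∈ Set.Icc x (x + h), ‖deriv g y - deriv g x‖ ≤ M * h := by
    intro y hy
    have h2 := Convex.norm_image_sub_le_of_norm_deriv_le (f := deriv g) (s := Set.univ) (C := M)
      (fun z _ => hd' z) (fun z _ => by
        have := hM z
        rwa [iteratedDeriv_succ, iteratedDeriv_one] at this) convex_univ
      (Set.mem_univ x) (Set.mem_univ y)
    refine h2.trans ?_
    have hM0 : 0 ≤ M := (norm_nonneg _).trans (hM x)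
    gcongr
    rw [Real.norm_eq_abs, abs_of_nonneg (by linarith [hy.1])]
    linarith [hy.2]
  have hG : ∀ y, HasDerivAt (fun y => g y - (y - x) • deriv g x) (deriv g y - deriv g x) y := by
    intro y
    have h3 := ((hasDerivAt_id y).sub_const x).smul_const (deriv g x)
    rw [one_smul] at h3
    exact (hd y).hasDerivAt.sub h3
  have h4 := Convex.norm_image_sub_le_of_norm_hasDerivWithin_le
    (s := Set.Icc x (x + h)) (C := M * h) (fun y _ => (hG y).hasDerivWithinAt) hlip
    (convex_Icc _ _) (x := x) (y := x + h) ⟨le_rfl, by linarith⟩ ⟨by linarith, le_rfl⟩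
  simp only [add_sub_cancel_left, sub_self, zero_smul, sub_zero] at h4
  rw [Real.norm_eq_abs, abs_of_pos hh] at h4
  have h5 : ‖h • deriv g x‖ ≤ 2 * ε + M * h * h := by
    have e : h • deriv g x = g (x + h) - g x - (g (x + h) - h • deriv g x - g x) := by abel
    rw [e]
    refine (norm_sub_le _ _).trans ?_
    linarith [norm_sub_le (g (x + h)) (g x)]
  rw [norm_smul, Real.norm_eq_abs, abs_of_pos hh] at h5
  rw [div_add' _ _ _ hh.ne', le_div_iff₀ hh]
  linarith

/-- Landau-type interpolation with step `h = (1 + |x|)^(-k)`: decay of `g` of order `2k` makes both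
`ε / h` and `M * h` of order `(1 + |x|)^(-k)`. As `h ≤ 1`, the weights at `x` and `x + h` differ by
a factor of at most 2. -/
theorem rapidDecay_deriv {E : Type*} [NormedAddCommGroup E] [NormedSpace ℝ E] {g : ℝ → E}
    (hg : ContDiff ℝ 2 g) {M : ℝ} (hM : ∀ y, ‖iteratedDeriv 2 g y‖ ≤ M)
    (hd : ∀ k : ℕ, ∃ C, ∀ x, (1 + |x|) ^ k * ‖g x‖ ≤ C) (k : ℕ) :
    ∃ C, ∀ x, (1 + |x|) ^ k * ‖deriv g x‖ ≤ C := by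
  obtain ⟨C, hC⟩ := hd (2 * k)
  have hC0 : 0 ≤ C := le_trans (by positivity) (hC 0)
  refine ⟨2 * (2 ^ (2 * k) * C) + M, fun x => ?_⟩
  set u := 1 + |x| with hu
  have hu1 : 1 ≤ u := by simp [hu]
  have hu0 : 0 < u := by linarith
  have hk1 : (u ^ k)⁻¹ ≤ 1 := inv_le_one_of_one_le₀ (one_le_pow₀ hu1)
  have hk0 : 0 < (u ^ k)⁻¹ := by positivity
  have key : ∀ y, u ≤ 2 * (1 + |y|) → ‖g y‖ ≤ 2 ^ (2 * k) * C / u ^ (2 * k) := by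
    intro y hy
    rw [le_div_iff₀ (by positivity)]
    calc ‖g y‖ * u ^ (2 * k) ≤ ‖g y‖ * (2 * (1 + |y|)) ^ (2 * k) := by gcongr
      _ = 2 ^ (2 * k) * ((1 + |y|) ^ (2 * k) * ‖g y‖) := by rw [mul_pow]; ring
      _ ≤ _ := by gcongr; exact hC y
  have := norm_deriv_le_of_norm_iteratedDeriv_two_le hg hk0
    (key x (by simp [hu]; linarith [abs_nonneg x]))
    (key (x + (u ^ k)⁻¹) (by
      have h1 := abs_sub_abs_le_abs_sub x (x + (u ^ k)⁻¹)
      rw [sub_add_cancel_left, abs_neg, abs_of_pos hk0] at h1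
      linarith [abs_nonneg (x + (u ^ k)⁻¹)])) hM
  calc u ^ k * ‖deriv g x‖
      ≤ u ^ k * (2 * (2 ^ (2 * k) * C / u ^ (2 * k)) / (u ^ k)⁻¹ + M * (u ^ k)⁻¹) := by gcongr
    _ = _ := by rw [mul_comm 2 k, pow_mul u]; field_simp

theorem rapidDecay_iteratedDeriv {E : Type*} [NormedAddCommGroup E] [NormedSpace ℝ E] {g : ℝ → E}
    (hg : ContDiff ℝ (⊤ : ℕ∞) g) (hM : ∀ n, ∃ M, ∀ y, ‖iteratedDeriv n g y‖ ≤ M)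
    (hd : ∀ k : ℕ, ∃ C, ∀ x, (1 + |x|) ^ k * ‖g x‖ ≤ C) (n k : ℕ) :
    ∃ C, ∀ x, (1 + |x|) ^ k * ‖iteratedDeriv n g x‖ ≤ C := by
  induction n generalizing k with
  | zero => simpa using hd k
  | succ n ih =>
    rw [iteratedDeriv_succ]
    obtain ⟨M, hM⟩ := hM (n + 2)
    refine rapidDecay_deriv (M := M) ?_ (fun y => ?_) ih k
    · rw [iteratedDeriv_eq_iterate]
      exact ContDiff.iterate_deriv' 2 n (contDiff_infty.1 hg (2 + n))
    · rw [iteratedDeriv_succ, iteratedDeriv_one, ← iteratedDeriv_succ, ← iteratedDeriv_succ]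
      exact hM y

/-! ### From characteristic functions to Schwartz densities -/

theorem norm_iteratedDeriv_charFun_le {ν : Measure ℝ} [IsFiniteMeasure ν] {n : ℕ}
    (hm : MemLp id n ν) (t : ℝ) : ‖iteratedDeriv n (charFun ν) t‖ ≤ ∫ x, |x| ^ n ∂ν := by
  rw [iteratedDeriv_charFun hm, norm_mul, norm_pow, Complex.norm_I, one_pow, one_mul]
  refine (norm_integral_le_integral_norm _).trans_eq ?_
  congr with x
  rw [norm_mul, ← Complex.ofReal_mul, Complex.norm_exp_ofReal_mul_I]
  simp

noncomputable def charFunSchwartz (ν : Measure ℝ) [IsFiniteMeasure ν] (hm : ∀ k : ℕ, MemLp id k ν)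
    (hd : ∀ k : ℕ, ∃ C, ∀ t, (1 + |t|) ^ k * ‖charFun ν t‖ ≤ C) : 𝓢(ℝ, ℂ) where
  toFun := charFun ν
  smooth' := contDiff_charFun' hm
  decay' k n := by
    obtain ⟨C, hC⟩ := rapidDecay_iteratedDeriv (contDiff_charFun' hm)
      (fun n => ⟨_, norm_iteratedDeriv_charFun_le (hm n)⟩) hd n k
    refine ⟨C, fun x => le_trans ?_ (hC x)⟩
    rw [norm_iteratedFDeriv_eq_norm_iteratedDeriv, Real.norm_eq_abs]
    gcongr
    linarith

theorem exists_schwartz_fourier_eq_charFun (ν : Measure ℝ) [IsFiniteMeasure ν]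
    (hm : ∀ k : ℕ, MemLp id k ν)
    (hd : ∀ k : ℕ, ∃ C, ∀ t, (1 + |t|) ^ k * ‖charFun ν t‖ ≤ C) :
    ∃ F : 𝓢(ℝ, ℂ), ∀ t : ℝ, charFun ν t = ∫ x : ℝ, Complex.exp (t * x * Complex.I) * F x := by
  have hpi : (-(2 * Real.pi)) ≠ 0 := by simp [Real.pi_ne_zero]
  -- Rescaling by `-2π` converts the kernel `exp(-2πixw)` of `𝓕` to `exp(itx)`.
  let ψ : 𝓢(ℝ, ℂ) := SchwartzMap.compCLMOfContinuousLinearEquiv ℂ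
    (ContinuousLinearEquiv.unitsEquivAut ℝ (Units.mk0 _ hpi)) (charFunSchwartz ν hm hd)
  have hψ : ∀ w, ψ w = charFun ν (w * (-(2 * Real.pi))) := fun w => rfl
  refine ⟨𝓕⁻ ψ, fun t => ?_⟩
  have h1 : 𝓕 (𝓕⁻ ψ) = ψ := FourierTransform.fourier_fourierInv_eq ψ
  have h2 := congrArg (fun f : 𝓢(ℝ, ℂ) => f (-(t / (2 * Real.pi)))) h1
  simp only [hψ, SchwartzMap.fourier_coe, Real.fourier_real_eq_integral_exp_smul] at h2
  rw [show -(t / (2 * Real.pi)) * (-(2 * Real.pi)) = t by field_simp] at h2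
  rw [← h2]
  congr with x
  rw [smul_eq_mul]
  congr 3
  push_cast
  have : (Real.pi : ℂ) ≠ 0 := by exact_mod_cast Real.pi_ne_zero
  field_simp

/-- By the conjugate symmetry of `φ`, `F` and its conjugate have the same transform; average the
two. -/
theorem integral_exp_mul_re {F : ℝ → ℂ} (hF : Integrable F) {φ : ℝ → ℂ}
    (h : ∀ t : ℝ, φ t = ∫ x : ℝ, Complex.exp (t * x * Complex.I) * F x)
    (hφ : ∀ t, φ (-t) = starRingEnd ℂ (φ t)) (t : ℝ) :
    ∫ x : ℝ, Complex.exp (t * x * Complex.I) * ((F x).re : ℂ) = φ t := by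
  have hexp : ∀ x : ℝ, ‖Complex.exp (t * x * Complex.I)‖ = 1 := fun x => by
    rw [← Complex.ofReal_mul, Complex.norm_exp_ofReal_mul_I]
  have hi : ∀ G : ℝ → ℂ, Integrable G →
      Integrable (fun x : ℝ => Complex.exp (t * x * Complex.I) * G x) := fun G hG =>
    hG.bdd_mul (c := 1) (by fun_prop) (ae_of_all _ fun x => (hexp x).le)
  have hc : Integrable (fun x => starRingEnd ℂ (F x)) :=
    (Complex.conjLIE.integrable_comp_iff (μ := volume) (φ := F)).2 hF
  have h2 : φ t = ∫ x : ℝ, Complex.exp (t * x * Complex.I) * starRingEnd ℂ (F x) := by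
    have := congrArg (starRingEnd ℂ) (hφ t)
    rw [Complex.conj_conj, h (-t), ← integral_conj] at this
    rw [← this]
    congr with x
    rw [map_mul, ← Complex.exp_conj]
    simp
  have h3 : ∀ x : ℝ, Complex.exp (t * x * Complex.I) * ((F x).re : ℂ) =
      (1 / 2 : ℂ) * (Complex.exp (t * x * Complex.I) * F x +
        Complex.exp (t * x * Complex.I) * starRingEnd ℂ (F x)) := fun x => by
    rw [Complex.re_eq_add_conj]; ring
  simp_rw [h3]
  rw [integral_const_mul, integral_add (hi _ hF) (hi _ hc), ← h, ← h2]
  ring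

theorem charFun_withDensity_ofReal {f : ℝ → ℝ} (hf : Measurable f) (h0 : ∀ x, 0 ≤ f x) (t : ℝ) :
    charFun (volume.withDensity fun x => ENNReal.ofReal (f x)) t =
      ∫ x : ℝ, Complex.exp (t * x * Complex.I) * (f x : ℂ) := by
  rw [charFun_apply_real, integral_withDensity_eq_integral_toReal_smul (by fun_prop) (by simp)]
  congr with x
  rw [ENNReal.toReal_ofReal (h0 x), Complex.real_smul, mul_comm]

/-- With `P` and `N` the measures of densities `f⁺` and `f⁻`, uniqueness of characteristic functions
gives `ν + N = P`. Since `P` ignores `{f < 0}`, so does `N`; this open set is then Lebesgue-null,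
hence empty. -/
theorem nonneg_and_eq_withDensity_of_charFun_eq {ν : Measure ℝ} [IsFiniteMeasure ν] {f : ℝ → ℝ}
    (hf : Continuous f) (hi : Integrable f)
    (h : ∀ t : ℝ, charFun ν t = ∫ x : ℝ, Complex.exp (t * x * Complex.I) * (f x : ℂ)) :
    (∀ x, 0 ≤ f x) ∧ ν = volume.withDensity fun x => ENNReal.ofReal (f x) := by
  set P := volume.withDensity fun x => ENNReal.ofReal (max (f x) 0) with hP
  set N := volume.withDensity fun x => ENNReal.ofReal (max (-f x) 0) with hN
  have hip : Integrable fun x => max (f x) 0 := hi.pos_part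
  have hin : Integrable fun x => max (-f x) 0 := hi.neg_part
  have : IsFiniteMeasure P := isFiniteMeasure_withDensity_ofReal hip.2
  have : IsFiniteMeasure N := isFiniteMeasure_withDensity_ofReal hin.2
  have key : ν + N = P := by
    refine Measure.ext_of_charFun ?_
    ext t
    have hexp : ∀ x : ℝ, ‖Complex.exp (t * x * Complex.I)‖ = 1 := fun x => by
      rw [← Complex.ofReal_mul, Complex.norm_exp_ofReal_mul_I]
    have hi' : ∀ G : ℝ → ℝ, Integrable G →
        Integrable (fun x : ℝ => Complex.exp (t * x * Complex.I) * (G x : ℂ)) := fun G hG =>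
      hG.ofReal.bdd_mul (c := 1) (by fun_prop) (ae_of_all _ fun x => (hexp x).le)
    have hadd : charFun (ν + N) t = charFun ν t + charFun N t := by
      have hint : ∀ κ : Measure ℝ, IsFiniteMeasure κ →
          Integrable (fun x : ℝ => Complex.exp (t * x * Complex.I)) κ := fun κ _ =>
        Integrable.of_bound (by fun_prop) 1 (ae_of_all _ fun x => (hexp x).le)
      simp only [charFun_apply_real]
      rw [integral_add_measure (hint _ inferInstance) (hint _ inferInstance)]
    rw [hadd, h, hN, hP, charFun_withDensity_ofReal (by fun_prop) (by simp),
      charFun_withDensity_ofReal (by fun_prop) (by simp),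
      ← integral_add (hi' _ hi) (hi' _ hin)]
    congr with x
    rw [← mul_add, ← Complex.ofReal_add]
    congr 2
    rcases le_total (f x) 0 with hx | hx
    · rw [max_eq_left (by linarith), max_eq_right hx]; ring
    · rw [max_eq_right (by linarith), max_eq_left hx]; ring
  have hs : MeasurableSet {x | f x < 0} := measurableSet_lt hf.measurable measurable_const
  have hP0 : P {x | f x < 0} = 0 := by
    rw [hP, withDensity_apply _ hs, setLIntegral_eq_zero_iff hs (by fun_prop)]
    refine ae_of_all _ fun x hx => ?_
    have hx' : f x < 0 := hx
    simp [hx'.le]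
  have hN0 : N {x | f x < 0} = 0 := by
    rw [← key] at hP0
    exact (add_eq_zero.1 hP0).2
  have hv : volume {x | f x < 0} = 0 := by
    rw [hN, withDensity_apply _ hs, setLIntegral_eq_zero_iff hs (by fun_prop)] at hN0
    refine measure_mono_null (fun x hx => ?_) (ae_iff.1 hN0)
    have hx' : f x < 0 := hx
    simp [hx']
  have h0 : ∀ x, 0 ≤ f x := by
    by_contra! hneg
    obtain ⟨x, hx⟩ := hneg
    exact ((isOpen_lt hf continuous_const).measure_pos volume ⟨x, hx⟩).ne' hv
  refine ⟨h0, ?_⟩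
  have hN' : N = 0 := by
    rw [hN]
    simp [h0, show (fun _ : ℝ => (0 : ENNReal)) = 0 from rfl]
  rw [hN', add_zero] at key
  rw [key, hP]
  simp [h0]

theorem exists_schwartz_density (ν : Measure ℝ) [IsProbabilityMeasure ν]
    (hm : ∀ k : ℕ, MemLp id k ν)
    (hd : ∀ k : ℕ, ∃ C, ∀ t, (1 + |t|) ^ k * ‖charFun ν t‖ ≤ C) :
    ∃ f : 𝓢(ℝ, ℝ), (∀ x, 0 ≤ f x) ∧ ∫ x, f x = 1 ∧
      ν = volume.withDensity fun x => ENNReal.ofReal (f x) := by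
  obtain ⟨F, hF⟩ := exists_schwartz_fourier_eq_charFun ν hm hd
  refine ⟨SchwartzMap.postcompCLM (𝕜 := ℝ) Complex.reCLM F, ?_⟩
  set f := SchwartzMap.postcompCLM (𝕜 := ℝ) Complex.reCLM F
  have hf : ∀ t : ℝ, charFun ν t = ∫ x : ℝ, Complex.exp (t * x * Complex.I) * (f x : ℂ) := fun t =>
    (integral_exp_mul_re F.integrable hF (fun t => charFun_neg t) t).symm
  obtain ⟨h0, h1⟩ := nonneg_and_eq_withDensity_of_charFun_eq f.continuous f.integrable hf
  refine ⟨h0, ?_, h1⟩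
  have := hf 0
  simp only [charFun_zero, probReal_univ, Complex.ofReal_zero, zero_mul, Complex.exp_zero, one_mul,
    integral_complex_ofReal] at this
  exact_mod_cast this.symm

/-! ### Almost sure convergence and sub-Gaussian limits -/

theorem ae_exists_tendsto_sum_of_iIndepFun {Ω : Type*} [MeasurableSpace Ω] {μ : Measure Ω}
    [IsProbabilityMeasure μ] {Y : ℕ → Ω → ℝ} (hY : ∀ n, Measurable (Y n)) (hind : iIndepFun Y μ)
    (hi : ∀ n, Integrable (Y n) μ) (h0 : ∀ n, μ[Y n] = 0) {C : ℝ≥0}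
    (hC : ∀ n, eLpNorm (fun ω => ∑ k ∈ Finset.range n, Y k ω) 1 μ ≤ C) :
    ∀ᵐ ω ∂μ, ∃ c, Tendsto (fun n => ∑ k ∈ Finset.range n, Y k ω) atTop (𝓝 c) := by
  have hs : ∀ n, StronglyMeasurable (Y n) := fun n => (hY n).stronglyMeasurable
  let ℱ := Filtration.natural Y hs
  -- The natural filtration at time `n` already contains `Y n`, hence the range `n + 1`.
  let M : ℕ → Ω → ℝ := fun n ω => ∑ k ∈ Finset.range (n + 1), Y k ω
  have hM : Martingale M ℱ μ := by
    refine martingale_of_condExp_sub_eq_zero_nat (fun n => ?_) (fun n => ?_) (fun n => ?_)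
    · refine Finset.stronglyMeasurable_fun_sum _ fun k hk => ?_
      exact (Filtration.stronglyAdapted_natural hs k).mono
        (ℱ.mono (Nat.lt_succ_iff.1 (Finset.mem_range.1 hk)))
    · exact integrable_finsetSum _ fun k _ => hi k
    · have : M (n + 1) - M n = Y (n + 1) := by
        funext ω
        simp [M, Finset.sum_range_succ _ (n + 1)]
      rw [this]
      refine (hind.condExp_natural_ae_eq_of_lt hs n.lt_succ_self).trans ?_
      rw [h0]
      rfl
  filter_upwards [hM.submartingale.exists_ae_tendsto_of_bdd (R := C) fun n => hC (n + 1)]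
    with ω ⟨c, hc⟩
  exact ⟨c, (tendsto_add_atTop_iff_nat 1).1 hc⟩

theorem ProbabilityTheory.HasSubgaussianMGF.mono {Ω : Type*} [MeasurableSpace Ω] {μ : Measure Ω}
    {X : Ω → ℝ} {c d : ℝ≥0} (h : HasSubgaussianMGF X c μ) (hcd : c ≤ d) :
    HasSubgaussianMGF X d μ :=
  ⟨h.integrable_exp_mul, fun t => (h.mgf_le t).trans (by gcongr)⟩

theorem ProbabilityTheory.HasSubgaussianMGF.eLpNorm_one_le {Ω : Type*} [MeasurableSpace Ω]
    {μ : Measure Ω} {X : Ω → ℝ} {c : ℝ≥0} (h : HasSubgaussianMGF X c μ) :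
    eLpNorm X 1 μ ≤ ENNReal.ofReal (2 * Real.exp (c / 2)) := by
  rw [eLpNorm_one_eq_lintegral_enorm, ← ofReal_integral_norm_eq_lintegral_enorm h.integrable]
  refine ENNReal.ofReal_le_ofReal ?_
  have h1 := h.mgf_le 1
  have h2 := h.mgf_le (-1)
  have i1 := h.integrable_exp_mul 1
  have i2 := h.integrable_exp_mul (-1)
  simp only [mgf, one_pow, mul_one, even_two, Even.neg_pow] at h1 h2
  calc ∫ ω, ‖X ω‖ ∂μ ≤ ∫ ω, (Real.exp (1 * X ω) + Real.exp (-1 * X ω)) ∂μ := by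
        refine integral_mono h.integrable.norm (i1.add i2) fun ω => ?_
        simp only [Real.norm_eq_abs]
        refine abs_le'.2 ⟨?_, ?_⟩
        · linarith [Real.add_one_le_exp (1 * X ω), Real.exp_pos (-1 * X ω)]
        · linarith [Real.add_one_le_exp (-1 * X ω), Real.exp_pos (1 * X ω)]
    _ ≤ _ := by rw [integral_add i1 i2]; linarith

/-- A pointwise a.e. limit of uniformly sub-Gaussian variables is sub-Gaussian. -/
theorem ProbabilityTheory.HasSubgaussianMGF.of_tendsto {Ω : Type*} [MeasurableSpace Ω]
    {μ : Measure Ω} {S : ℕ → Ω → ℝ} {X : Ω → ℝ} {c : ℝ≥0}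
    (h : ∀ n, HasSubgaussianMGF (S n) c μ)
    (hX : AEMeasurable X μ) (hlim : ∀ᵐ ω ∂μ, Tendsto (fun n => S n ω) atTop (𝓝 (X ω))) :
    HasSubgaussianMGF X c μ := by
  have key : ∀ t : ℝ, ∫⁻ ω, ENNReal.ofReal (Real.exp (t * X ω)) ∂μ ≤
      ENNReal.ofReal (Real.exp (c * t ^ 2 / 2)) := by
    intro t
    have e : ∫⁻ ω, ENNReal.ofReal (Real.exp (t * X ω)) ∂μ =
        ∫⁻ ω, liminf (fun n => ENNReal.ofReal (Real.exp (t * S n ω))) atTop ∂μ := by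
      refine lintegral_congr_ae ?_
      filter_upwards [hlim] with ω hω
      exact (((ENNReal.continuous_ofReal.comp (Real.continuous_exp.comp
        (continuous_const_mul t))).tendsto _).comp hω).liminf_eq.symm
    rw [e]
    -- Fatou's lemma.
    refine (lintegral_liminf_le' fun n => ?_).trans ?_
    · exact ((h n).integrable_exp_mul t).aemeasurable.ennreal_ofReal
    · refine liminf_le_of_le (by isBoundedDefault) fun b hb => ?_
      obtain ⟨n, hn⟩ := hb.exists
      refine hn.trans ?_
      rw [← ofReal_integral_eq_lintegral_ofReal ((h n).integrable_exp_mul t)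
        (ae_of_all _ fun ω => (Real.exp_pos _).le)]
      exact ENNReal.ofReal_le_ofReal ((h n).mgf_le t)
  have hint : ∀ t : ℝ, Integrable (fun ω => Real.exp (t * X ω)) μ := fun t =>
    (lintegral_ofReal_ne_top_iff_integrable
      (by fun_prop) (ae_of_all _ fun ω => (Real.exp_pos _).le)).1
      ((key t).trans_lt ENNReal.ofReal_lt_top).ne
  refine ⟨hint, fun t => ?_⟩
  have := key t
  rwa [← ofReal_integral_eq_lintegral_ofReal (hint t) (ae_of_all _ fun ω => (Real.exp_pos _).le),
    ENNReal.ofReal_le_ofReal_iff (Real.exp_pos _).le] at this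

theorem tendsto_charFun_map {Ω : Type*} [MeasurableSpace Ω] {μ : Measure Ω} [IsFiniteMeasure μ]
    {S : ℕ → Ω → ℝ} {X : Ω → ℝ} (hS : ∀ n, AEMeasurable (S n) μ) (hX : AEMeasurable X μ)
    (hlim : ∀ᵐ ω ∂μ, Tendsto (fun n => S n ω) atTop (𝓝 (X ω))) (t : ℝ) :
    Tendsto (fun n => charFun (μ.map (S n)) t) atTop (𝓝 (charFun (μ.map X) t)) := by
  have e : ∀ Y : Ω → ℝ, AEMeasurable Y μ →
      charFun (μ.map Y) t = ∫ ω, Complex.exp (t * Y ω * Complex.I) ∂μ := fun Y hY => by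
    rw [charFun_apply_real, integral_map hY (by fun_prop)]
  simp_rw [fun n => e _ (hS n), e _ hX]
  refine tendsto_integral_of_dominated_convergence (fun _ => 1) (fun n => ?_)
    (integrable_const _) (fun n => ae_of_all _ fun ω => ?_) ?_
  · have : Continuous fun x : ℝ => Complex.exp (t * x * Complex.I) := by fun_prop
    exact (this.measurable.comp_aemeasurable (hS n)).aestronglyMeasurable
  · rw [← Complex.ofReal_mul, Complex.norm_exp_ofReal_mul_I]
  · filter_upwards [hlim] with ω hω
    have : Continuous fun x : ℝ => Complex.exp (t * x * Complex.I) := by fun_prop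
    exact (this.tendsto _).comp hω

/-! ### Law of a single coefficient -/

section Coeff

variable {Ω : Type*} [MeasurableSpace Ω] {μ : Measure Ω} [IsProbabilityMeasure μ]
  {p s : ℝ} {R : ℕ → Ω → ℝ}

theorem IsZetaCoeffSeq.map_eq (hR : IsZetaCoeffSeq μ p R) (hp0 : 0 < p) (hp1 : p ≤ 1) (n : ℕ) :
    μ.map (R n) = ENNReal.ofReal (1 - p) • Measure.dirac 0 +
      (ENNReal.ofReal (p / 2) • Measure.dirac 1 + ENNReal.ofReal (p / 2) • Measure.dirac (-1)) := by
  have hm := hR.measurable n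
  have h0 : μ.map (R n) {0} = ENNReal.ofReal (1 - p) := by
    rw [Measure.map_apply hm (measurableSet_singleton _)]; exact hR.prob_zero n
  have h1 : μ.map (R n) {1} = ENNReal.ofReal (p / 2) := by
    rw [Measure.map_apply hm (measurableSet_singleton _)]; exact hR.prob_one n
  have h2 : μ.map (R n) {-1} = ENNReal.ofReal (p / 2) := by
    rw [Measure.map_apply hm (measurableSet_singleton _)]; exact hR.prob_neg_one n
  have hP : IsProbabilityMeasure (μ.map (R n)) := Measure.isProbabilityMeasure_map hm.aemeasurable
  have d1 : Disjoint ({1} : Set ℝ) {-1} := by simp; norm_num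
  have d0 : Disjoint ({0} : Set ℝ) ({1} ∪ {-1}) := by simp
  have hms : MeasurableSet (({1} : Set ℝ) ∪ {-1}) :=
    (measurableSet_singleton _).union (measurableSet_singleton _)
  have hu : μ.map (R n) ({0} ∪ ({1} ∪ {-1})) = 1 := by
    rw [measure_union d0 hms, measure_union d1 (measurableSet_singleton _), h0, h1, h2,
      ← ENNReal.ofReal_add (by positivity) (by positivity),
      ← ENNReal.ofReal_add (by linarith) (by positivity)]
    ring_nf
    simp
  have hae := (prob_compl_eq_zero_iff ((measurableSet_singleton _).union hms)).2 hu
  -- The three atoms carry total mass 1, so restricting to them changes nothing.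
  rw [← Measure.restrict_eq_self_of_ae_mem (μ := μ.map (R n)) (s := {0} ∪ ({1} ∪ {-1}))
    (by rw [ae_iff]; exact hae), Measure.restrict_union d0 hms,
    Measure.restrict_union d1 (measurableSet_singleton _)]
  simp only [Measure.restrict_singleton, h0, h1, h2]

theorem IsZetaCoeffSeq.ae_abs_le_one (hR : IsZetaCoeffSeq μ p R) (hp0 : 0 < p) (hp1 : p ≤ 1) :
    ∀ᵐ ω ∂μ, ∀ n, |R n ω| ≤ 1 := by
  refine ae_all_iff.2 fun n => ?_
  have : ∀ᵐ x ∂(μ.map (R n)), |x| ≤ 1 := by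
    rw [hR.map_eq hp0 hp1]
    simp only [ae_add_measure_iff]
    refine ⟨Measure.ae_smul_measure ?_ _, Measure.ae_smul_measure ?_ _,
      Measure.ae_smul_measure ?_ _⟩ <;> simp [ae_dirac_eq]
  exact ae_of_ae_map (hR.measurable n).aemeasurable this

theorem IsZetaCoeffSeq.integral_comp {E : Type*} [NormedAddCommGroup E] [NormedSpace ℝ E]
    [CompleteSpace E] (hR : IsZetaCoeffSeq μ p R) (hp0 : 0 < p) (hp1 : p ≤ 1) (n : ℕ)
    (g : ℝ → E) :
    ∫ x, g x ∂(μ.map (R n)) = (1 - p) • g 0 + ((p / 2) • g 1 + (p / 2) • g (-1)) := by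
  have hd : ∀ (c : ℝ) (a : ℝ), Integrable g (ENNReal.ofReal c • Measure.dirac a) := fun c a =>
    (integrable_dirac (by simp [enorm_lt_top])).smul_measure ENNReal.ofReal_ne_top
  rw [hR.map_eq hp0 hp1, integral_add_measure (hd _ _) ((hd _ _).add_measure (hd _ _)),
    integral_add_measure (hd _ _) (hd _ _)]
  simp only [integral_smul_measure, integral_dirac]
  rw [ENNReal.toReal_ofReal (by linarith), ENNReal.toReal_ofReal (by linarith)]

theorem IsZetaCoeffSeq.integral_eq_zero (hR : IsZetaCoeffSeq μ p R) (hp0 : 0 < p) (hp1 : p ≤ 1)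
    (n : ℕ) : μ[R n] = 0 := by
  have := hR.integral_comp hp0 hp1 n id
  rw [integral_map (hR.measurable n).aemeasurable (by fun_prop)] at this
  simpa using this

theorem IsZetaCoeffSeq.charFun_map (hR : IsZetaCoeffSeq μ p R) (hp0 : 0 < p) (hp1 : p ≤ 1)
    (n : ℕ) (t : ℝ) : charFun (μ.map (R n)) t = ((1 - p + p * Real.cos t : ℝ) : ℂ) := by
  rw [charFun_apply_real, hR.integral_comp hp0 hp1 n]
  simp only [Complex.real_smul]
  push_cast
  rw [Complex.cos]
  simp
  ring

theorem IsZetaCoeffSeq.hasSubgaussianMGF (hR : IsZetaCoeffSeq μ p R) (hp0 : 0 < p) (hp1 : p ≤ 1)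
    (n : ℕ) : HasSubgaussianMGF (R n) 1 μ := by
  -- Hoeffding's lemma; the constant is `((1 - (-1)) / 2)^2 = 1`.
  have := hasSubgaussianMGF_of_mem_Icc_of_integral_eq_zero (a := -1) (b := 1)
    (hR.measurable n).aemeasurable
    ((hR.ae_abs_le_one hp0 hp1).mono fun ω h => abs_le.1 (h n)) (hR.integral_eq_zero hp0 hp1 n)
  convert this
  rw [← NNReal.coe_inj]
  norm_num

end Coeff

/-! ### Failure of analyticity for laws bounded above -/

theorem not_analyticOnNhd_of_ae_le {ν : Measure ℝ} {f : ℝ → ℝ} (hf : Continuous f)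
    (h0 : ∀ x, 0 ≤ f x) (h1 : ∫ x, f x = 1)
    (hν : ν = volume.withDensity fun x => ENNReal.ofReal (f x)) {B : ℝ} (hB : ∀ᵐ x ∂ν, x ≤ B) :
    ¬ AnalyticOnNhd ℝ f Set.univ := by
  intro han
  have hz : volume (Set.Ioi B ∩ {x | 0 < f x}) = 0 := by
    have h2 : ν (Set.Ioi B) = 0 := by
      refine measure_mono_null (fun x hx => ?_) (ae_iff.1 hB)
      simpa using hx
    rw [hν, withDensity_apply _ measurableSet_Ioi,
      setLIntegral_eq_zero_iff measurableSet_Ioi (by fun_prop)] at h2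
    refine measure_mono_null (fun x hx => ?_) (ae_iff.1 h2)
    have : 0 < f x := hx.2
    simpa [this] using hx.1
  have hzero : ∀ x ∈ Set.Ioi B, f x = 0 := by
    intro x hx
    by_contra hne
    have ho : IsOpen (Set.Ioi B ∩ {x | 0 < f x}) :=
      isOpen_Ioi.inter (isOpen_lt continuous_const hf)
    exact (ho.measure_pos volume ⟨x, hx, lt_of_le_of_ne (h0 x) (Ne.symm hne)⟩).ne' hz
  have := han.eqOn_zero_of_preconnected_of_eventuallyEq_zero isPreconnected_univ
    (Set.mem_univ (B + 1))
    ((isOpen_Ioi.mem_nhds (show B + 1 ∈ Set.Ioi B by simp)) |> fun h =>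
      Filter.mem_of_superset h hzero)
  have hf0 : f = 0 := funext fun x => this (Set.mem_univ x)
  simp [hf0] at h1

/-! ### Convergence and decay of the trigonometric product -/

theorem summable_one_div_nat_add_one_rpow {r : ℝ} (hr : 1 < r) :
    Summable fun n : ℕ => 1 / ((n : ℝ) + 1) ^ r := by
  refine ((Real.summable_one_div_nat_add_rpow 1 r).2 hr).congr fun n => ?_
  rw [abs_of_nonneg (by positivity)]

theorem summable_sq_one_div_nat_add_one_rpow {s : ℝ} (hs : 1 / 2 < s) :
    Summable fun n : ℕ => (1 / ((n : ℝ) + 1) ^ s) ^ 2 := by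
  refine (summable_one_div_nat_add_one_rpow (r := s * 2) (by linarith)).congr fun n => ?_
  rw [Real.rpow_mul (by positivity)]
  simp

section Product

variable {p s : ℝ}

theorem multipliable_cloitreFactor (hp0 : 0 < p) (hp1 : p ≤ 1) (hs : 1 / 2 < s) (t : ℝ) :
    Multipliable (cloitreFactor p s t) := by
  have hsum : Summable fun n : ℕ => p * (Real.cos (t / ((n : ℝ) + 1) ^ s) - 1) := by
    refine ((summable_sq_one_div_nat_add_one_rpow hs).mul_left (t ^ 2)).of_norm_bounded
      fun n => ?_
    rw [Real.norm_eq_abs, abs_mul, abs_of_pos hp0, abs_sub_comm,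
      abs_of_nonneg (by linarith [Real.cos_le_one (t / ((n : ℝ) + 1) ^ s)])]
    have h1 := Real.one_sub_sq_div_two_le_cos (x := t / ((n : ℝ) + 1) ^ s)
    have h2 : (t / ((n : ℝ) + 1) ^ s) ^ 2 = t ^ 2 * (1 / ((n : ℝ) + 1) ^ s) ^ 2 := by ring
    have h3 := Real.cos_le_one (t / ((n : ℝ) + 1) ^ s)
    nlinarith [sq_nonneg (t / ((n : ℝ) + 1) ^ s)]
  refine (Real.multipliable_one_add_of_summable hsum).congr fun n => ?_
  rw [cloitreFactor]
  ring

theorem abs_cloitreFactor_le_one (hp0 : 0 < p) (hp1 : p ≤ 1) (t : ℝ) (n : ℕ) :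
    |cloitreFactor p s t n| ≤ 1 := by
  have h1 := Real.cos_le_one (t / ((n : ℝ) + 1) ^ s)
  have h2 := Real.neg_one_le_cos (t / ((n : ℝ) + 1) ^ s)
  rw [cloitreFactor, abs_le]
  constructor <;> nlinarith

/-- In this window `|t|^(1/s) ≤ n + 1 ≤ 4 |t|^(1/s)`, the 4 coming from `2⌈r⌉ < 2r + 2 ≤ 4r` for `r
≥ 1`. So the angle lies in `[4^(-s), 1]`, where cosine is nonnegative and decreasing. -/
theorem abs_cloitreFactor_le (hp0 : 0 < p) (hp1 : p ≤ 1) (hs : 0 < s) {t : ℝ} (ht : 1 ≤ |t|)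
    {n : ℕ} (hn : n ∈ Finset.Ico ⌈|t| ^ s⁻¹⌉₊ (2 * ⌈|t| ^ s⁻¹⌉₊)) :
    |cloitreFactor p s t n| ≤ 1 - p + p * Real.cos ((4 : ℝ) ^ s)⁻¹ := by
  rw [Finset.mem_Ico] at hn
  set M := ⌈|t| ^ s⁻¹⌉₊
  have ht0 : 0 ≤ |t| := abs_nonneg t
  have hr1 : 1 ≤ |t| ^ s⁻¹ := Real.one_le_rpow ht (by positivity)
  have hr : (|t| ^ s⁻¹) ^ s = |t| := Real.rpow_inv_rpow ht0 hs.ne'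
  have hM1 : |t| ^ s⁻¹ ≤ M := Nat.le_ceil _
  have hM2 : (M : ℝ) < |t| ^ s⁻¹ + 1 := Nat.ceil_lt_add_one (by positivity)
  have hn1 : (M : ℝ) ≤ n := by exact_mod_cast hn.1
  have hn2 : (n : ℝ) + 1 ≤ 2 * M := by exact_mod_cast hn.2
  have hpos : (0 : ℝ) < ((n : ℝ) + 1) ^ s := by positivity
  set θ := |t| / ((n : ℝ) + 1) ^ s
  have hlow : |t| ≤ ((n : ℝ) + 1) ^ s := by
    calc |t| = (|t| ^ s⁻¹) ^ s := hr.symm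
      _ ≤ _ := Real.rpow_le_rpow (by positivity) (by linarith) hs.le
  have hup : ((n : ℝ) + 1) ^ s ≤ 4 ^ s * |t| := by
    calc ((n : ℝ) + 1) ^ s ≤ (4 * |t| ^ s⁻¹) ^ s :=
          Real.rpow_le_rpow (by positivity) (by linarith) hs.le
      _ = _ := by rw [Real.mul_rpow (by positivity) (by positivity), hr]
  have hθ1 : θ ≤ 1 := (div_le_one hpos).2 hlow
  have hθ0 : ((4 : ℝ) ^ s)⁻¹ ≤ θ := by
    rw [inv_eq_one_div, div_le_div_iff₀ (by positivity) hpos]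
    linarith
  have hcos : Real.cos (t / ((n : ℝ) + 1) ^ s) = Real.cos θ := by
    rw [← Real.cos_abs, abs_div, abs_of_pos hpos]
  have hθp : 0 ≤ θ := by positivity
  have hc0 : 0 ≤ Real.cos θ := Real.cos_nonneg_of_mem_Icc
    ⟨by linarith [Real.pi_pos], by linarith [Real.two_le_pi]⟩
  have hc1 : Real.cos θ ≤ Real.cos ((4 : ℝ) ^ s)⁻¹ :=
    Real.cos_le_cos_of_nonneg_of_le_pi (by positivity) (by linarith [Real.two_le_pi]) hθ0
  rw [cloitreFactor, hcos, abs_of_nonneg (by nlinarith)]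
  gcongr

theorem abs_cloitre_le_one (hp0 : 0 < p) (hp1 : p ≤ 1) (hs : 1 / 2 < s) (t : ℝ) :
    |cloitre p s t| ≤ 1 := by
  refine le_of_tendsto (multipliable_cloitreFactor hp0 hp1 hs t).hasProd.tendsto_prod_nat.abs
    (Eventually.of_forall fun N => ?_)
  rw [Finset.abs_prod]
  exact Finset.prod_le_one (fun _ _ => abs_nonneg _)
    fun n _ => abs_cloitreFactor_le_one hp0 hp1 t n

theorem abs_cloitre_le_pow (hp0 : 0 < p) (hp1 : p ≤ 1) (hs : 1 / 2 < s) {t : ℝ} (ht : 1 ≤ |t|) :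
    |cloitre p s t| ≤ (1 - p + p * Real.cos ((4 : ℝ) ^ s)⁻¹) ^ ⌈|t| ^ s⁻¹⌉₊ := by
  set M := ⌈|t| ^ s⁻¹⌉₊
  set q := 1 - p + p * Real.cos ((4 : ℝ) ^ s)⁻¹
  refine le_of_tendsto (multipliable_cloitreFactor hp0 hp1 hs t).hasProd.tendsto_prod_nat.abs
    ((eventually_ge_atTop (2 * M)).mono fun N hN => ?_)
  rw [Finset.abs_prod]
  calc ∏ n ∈ Finset.range N, |cloitreFactor p s t n|
      ≤ ∏ n ∈ Finset.range N, if n ∈ Finset.Ico M (2 * M) then q else 1 := by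
        refine Finset.prod_le_prod (fun _ _ => abs_nonneg _) fun n _ => ?_
        split_ifs with h
        · exact abs_cloitreFactor_le hp0 hp1 (by linarith) ht h
        · exact abs_cloitreFactor_le_one hp0 hp1 t n
    _ = q ^ M := by
        rw [Finset.prod_ite_mem, Finset.prod_const,
          Finset.inter_eq_right.2 fun n hn => by
            rw [Finset.mem_Ico] at hn; exact Finset.mem_range.2 (by omega),
          Nat.card_Ico]
        congr 1
        omega

theorem rapidDecay_cloitre (hp0 : 0 < p) (hp1 : p ≤ 1) (hs : 1 / 2 < s) (k : ℕ) :
    ∃ C, ∀ t, (1 + |t|) ^ k * |cloitre p s t| ≤ C := by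
  have hs0 : 0 < s := by linarith
  set q := 1 - p + p * Real.cos ((4 : ℝ) ^ s)⁻¹ with hq
  have h4 : 0 < ((4 : ℝ) ^ s)⁻¹ := by positivity
  have h4' : ((4 : ℝ) ^ s)⁻¹ ≤ 1 := inv_le_one_of_one_le₀ (Real.one_le_rpow (by norm_num) hs0.le)
  have hq0 : 0 ≤ q := by
    have : 0 ≤ Real.cos ((4 : ℝ) ^ s)⁻¹ := Real.cos_nonneg_of_mem_Icc
      ⟨by linarith [Real.pi_pos], by linarith [Real.two_le_pi]⟩
    nlinarith
  have hq1 : q < 1 := by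
    have : Real.cos ((4 : ℝ) ^ s)⁻¹ < 1 := by
      rw [← Real.cos_zero]
      exact Real.cos_lt_cos_of_nonneg_of_le_pi le_rfl (by linarith [Real.two_le_pi]) h4
    nlinarith
  -- Rounding `s` up bounds `|t| ≤ M^s` by a natural power of `M`, so the geometric decay of `q^M`
  -- absorbs it.
  set m := ⌈s⌉₊
  obtain ⟨C, hC⟩ := (tendsto_pow_const_mul_const_pow_of_lt_one (m * k) hq0 hq1).bddAbove_range
  refine ⟨max (2 ^ k) (2 ^ k * C), fun t => ?_⟩
  rcases lt_or_ge |t| 1 with ht | ht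
  · refine le_max_of_le_left ?_
    calc (1 + |t|) ^ k * |cloitre p s t| ≤ 2 ^ k * 1 := by
          gcongr
          · linarith
          · exact abs_cloitre_le_one hp0 hp1 hs t
      _ = _ := mul_one _
  · refine le_max_of_le_right ?_
    set M := ⌈|t| ^ s⁻¹⌉₊ with hM
    have hM1 : |t| ^ s⁻¹ ≤ M := Nat.le_ceil _
    have hM2 : (1 : ℝ) ≤ M := (Real.one_le_rpow ht (by positivity)).trans hM1
    have htM : |t| ≤ (M : ℝ) ^ m := by
      calc |t| = (|t| ^ s⁻¹) ^ s := (Real.rpow_inv_rpow (abs_nonneg t) hs0.ne').symm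
        _ ≤ (M : ℝ) ^ s := Real.rpow_le_rpow (by positivity) hM1 hs0.le
        _ ≤ (M : ℝ) ^ (m : ℝ) := Real.rpow_le_rpow_of_exponent_le hM2 (Nat.le_ceil s)
        _ = _ := Real.rpow_natCast _ _
    calc (1 + |t|) ^ k * |cloitre p s t| ≤ (2 * (M : ℝ) ^ m) ^ k * q ^ M := by
          gcongr
          · linarith
          · exact abs_cloitre_le_pow hp0 hp1 hs ht
      _ = 2 ^ k * ((M : ℝ) ^ (m * k) * q ^ M) := by rw [mul_pow, pow_mul]; ring
      _ ≤ 2 ^ k * C := by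
          gcongr
          exact hC ⟨M, rfl⟩

end Product

/-! ### The random walk and its limit -/

theorem IsZetaCoeffSeq.iIndepFun_mul {Ω : Type*} [MeasurableSpace Ω] {μ : Measure Ω} {p : ℝ}
    {R : ℕ → Ω → ℝ} (hR : IsZetaCoeffSeq μ p R) (a : ℕ → ℝ) :
    iIndepFun (fun n ω => R n ω * a n) μ :=
  hR.indep.comp (fun n x => x * a n) fun _ => by fun_prop

theorem IsZetaCoeffSeq.measurable_zetaWalk {Ω : Type*} [MeasurableSpace Ω] {μ : Measure Ω} {p : ℝ}
    {R : ℕ → Ω → ℝ} (hR : IsZetaCoeffSeq μ p R) (s : ℝ) (N : ℕ) :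
    Measurable (zetaWalk R s N) :=
  Finset.measurable_fun_sum _ fun n _ => (hR.measurable n).mul_const _

section Walk

variable {Ω : Type*} [MeasurableSpace Ω] {μ : Measure Ω} [IsProbabilityMeasure μ]
  {p s : ℝ} {R : ℕ → Ω → ℝ}

theorem IsZetaCoeffSeq.exists_hasSubgaussianMGF_zetaWalk (hR : IsZetaCoeffSeq μ p R)
    (hp0 : 0 < p) (hp1 : p ≤ 1) (hs : 1 / 2 < s) :
    ∃ c : ℝ≥0, ∀ N, HasSubgaussianMGF (zetaWalk R s N) c μ := by
  -- Variance proxies of the independent terms add up, and their full sum serves every `N`.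
  let c : ℕ → ℝ≥0 := fun n => ⟨(1 / ((n : ℝ) + 1) ^ s) ^ 2, sq_nonneg _⟩
  have hc : Summable c := NNReal.summable_coe.1 (summable_sq_one_div_nat_add_one_rpow hs)
  refine ⟨∑' n, c n, fun N => ?_⟩
  refine HasSubgaussianMGF.mono ?_ (hc.sum_le_tsum (Finset.range N) fun _ _ => zero_le)
  refine HasSubgaussianMGF.sum_of_iIndepFun (hR.iIndepFun_mul _) fun n _ => ?_
  have := (hR.hasSubgaussianMGF hp0 hp1 n).const_mul (1 / ((n : ℝ) + 1) ^ s)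
  simp_rw [mul_comm (1 / ((n : ℝ) + 1) ^ s)] at this
  exact mul_one (c n) ▸ this

theorem IsZetaCoeffSeq.ae_tendsto_zetaWalk (hR : IsZetaCoeffSeq μ p R)
    (hp0 : 0 < p) (hp1 : p ≤ 1) (hs : 1 / 2 < s) :
    ∀ᵐ ω ∂μ, Tendsto (fun N : ℕ => zetaWalk R s N ω) atTop (𝓝 (randomZeta R s ω)) := by
  obtain ⟨c, hc⟩ := hR.exists_hasSubgaussianMGF_zetaWalk hp0 hp1 hs
  have := ae_exists_tendsto_sum_of_iIndepFun
    (fun n => (hR.measurable n).mul_const (1 / ((n : ℝ) + 1) ^ s)) (hR.iIndepFun_mul _)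
    (fun n => (hR.hasSubgaussianMGF hp0 hp1 n).integrable.mul_const _)
    (fun n => by rw [integral_mul_const, hR.integral_eq_zero hp0 hp1, zero_mul])
    (fun N => (hc N).eLpNorm_one_le)
  filter_upwards [this] with ω hω
  exact tendsto_nhds_limUnder hω

theorem IsZetaCoeffSeq.aemeasurable_randomZeta (hR : IsZetaCoeffSeq μ p R)
    (hp0 : 0 < p) (hp1 : p ≤ 1) (hs : 1 / 2 < s) : AEMeasurable (randomZeta R s) μ :=
  aemeasurable_of_tendsto_metrizable_ae atTop
    (fun N => (hR.measurable_zetaWalk s N).aemeasurable) (hR.ae_tendsto_zetaWalk hp0 hp1 hs)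

theorem IsZetaCoeffSeq.charFun_map_zetaWalk (hR : IsZetaCoeffSeq μ p R)
    (hp0 : 0 < p) (hp1 : p ≤ 1) (s t : ℝ) (N : ℕ) :
    charFun (μ.map (zetaWalk R s N)) t =
      ((∏ n ∈ Finset.range N, cloitreFactor p s t n : ℝ) : ℂ) := by
  have h1 := iIndepFun.charFun_map_fun_finsetSum_eq_prod (s := Finset.range N)
    (fun n _ => ((hR.measurable n).mul_const (1 / ((n : ℝ) + 1) ^ s)).aemeasurable)
    ((hR.iIndepFun_mul _).restrict _)
  have h2 := congrFun h1 t
  change charFun (μ.map (zetaWalk R s N)) t = _ at h2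
  rw [h2, Finset.prod_apply, Complex.ofReal_prod]
  refine Finset.prod_congr rfl fun n _ => ?_
  simp_rw [mul_comm _ (1 / ((n : ℝ) + 1) ^ s)]
  rw [charFun_map_mul_comp (hR.measurable n).aemeasurable, hR.charFun_map hp0 hp1, cloitreFactor,
    one_div_mul_eq_div]

theorem IsZetaCoeffSeq.charFun_map_randomZeta (hR : IsZetaCoeffSeq μ p R)
    (hp0 : 0 < p) (hp1 : p ≤ 1) (hs : 1 / 2 < s) (t : ℝ) :
    charFun (μ.map (randomZeta R s)) t = (cloitre p s t : ℂ) := by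
  have h1 := tendsto_charFun_map (fun N => (hR.measurable_zetaWalk s N).aemeasurable)
    (hR.aemeasurable_randomZeta hp0 hp1 hs) (hR.ae_tendsto_zetaWalk hp0 hp1 hs) t
  simp_rw [hR.charFun_map_zetaWalk hp0 hp1] at h1
  exact tendsto_nhds_unique h1 ((Complex.continuous_ofReal.tendsto _).comp
    (multipliable_cloitreFactor hp0 hp1 hs t).hasProd.tendsto_prod_nat)

theorem IsZetaCoeffSeq.memLp_id_map_randomZeta (hR : IsZetaCoeffSeq μ p R)
    (hp0 : 0 < p) (hp1 : p ≤ 1) (hs : 1 / 2 < s) (k : ℕ) :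
    MemLp id k (μ.map (randomZeta R s)) := by
  obtain ⟨c, hc⟩ := hR.exists_hasSubgaussianMGF_zetaWalk hp0 hp1 hs
  have hm := hR.aemeasurable_randomZeta hp0 hp1 hs
  have h := HasSubgaussianMGF.of_tendsto hc hm (hR.ae_tendsto_zetaWalk hp0 hp1 hs)
  rw [memLp_map_measure_iff (by fun_prop) hm]
  exact_mod_cast h.memLp k

theorem IsZetaCoeffSeq.ae_map_randomZeta_le (hR : IsZetaCoeffSeq μ p R)
    (hp0 : 0 < p) (hp1 : p ≤ 1) (hs : 1 < s) :
    ∀ᵐ x ∂(μ.map (randomZeta R s)), x ≤ ∑' n : ℕ, 1 / ((n : ℝ) + 1) ^ s := by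
  have hs' : 1 / 2 < s := by linarith
  rw [ae_map_iff (hR.aemeasurable_randomZeta hp0 hp1 hs') measurableSet_Iic]
  filter_upwards [hR.ae_tendsto_zetaWalk hp0 hp1 hs', hR.ae_abs_le_one hp0 hp1] with ω h1 h2
  refine le_of_tendsto h1 (Eventually.of_forall fun N => ?_)
  refine le_trans (Finset.sum_le_sum fun n _ => ?_)
    ((summable_one_div_nat_add_one_rpow hs).sum_le_tsum (Finset.range N) fun n _ => by positivity)
  exact mul_le_of_le_one_left (by positivity) (abs_le.1 (h2 n)).2

end Walk

/-! ### The main theorem -/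

theorem mainTheorem3 {Ω : Type*} [MeasurableSpace Ω] (μ : Measure Ω) [IsProbabilityMeasure μ]
    (p s : ℝ) (hp0 : 0 < p) (hp1 : p ≤ 1) (hs : 1 / 2 < s)
    (R : ℕ → Ω → ℝ) (hR : IsZetaCoeffSeq μ p R) :
    (∀ᵐ ω ∂μ, Tendsto (fun N : ℕ => zetaWalk R s N ω) atTop (𝓝 (randomZeta R s ω))) ∧
    AEMeasurable (randomZeta R s) μ ∧
    (∀ t : ℝ, Multipliable (cloitreFactor p s t) ∧
      charFun (μ.map (randomZeta R s)) t = (cloitre p s t : ℂ)) ∧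
    μ.map (randomZeta R s) ≪ volume ∧
    ∃ f : SchwartzMap ℝ ℝ,
      (∀ x, 0 ≤ f x) ∧
      ∫ x, f x = 1 ∧
      μ.map (randomZeta R s) = volume.withDensity (fun x => ENNReal.ofReal (f x)) ∧
      (1 < s → ¬ AnalyticOnNhd ℝ (fun x => f x) Set.univ) := by
  have hm := hR.aemeasurable_randomZeta hp0 hp1 hs
  have hP : IsProbabilityMeasure (μ.map (randomZeta R s)) := Measure.isProbabilityMeasure_map hm
  obtain ⟨f, h0, h1, hf⟩ := exists_schwartz_density (μ.map (randomZeta R s))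
    (hR.memLp_id_map_randomZeta hp0 hp1 hs) fun k => by
      obtain ⟨C, hC⟩ := rapidDecay_cloitre hp0 hp1 hs k
      refine ⟨C, fun t => ?_⟩
      rw [hR.charFun_map_randomZeta hp0 hp1 hs, Complex.norm_real]
      exact hC t
  refine ⟨hR.ae_tendsto_zetaWalk hp0 hp1 hs, hm, fun t =>
    ⟨multipliable_cloitreFactor hp0 hp1 hs t, hR.charFun_map_randomZeta hp0 hp1 hs t⟩, ?_,
    f, h0, h1, hf, fun hs1 =>
      not_analyticOnNhd_of_ae_le f.continuous h0 h1 hf (hR.ae_map_randomZeta_le hp0 hp1 hs1)⟩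
  rw [hf]
  exact withDensity_absolutelyContinuous _ _
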